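/- A stochastic graph $G=(U,V,E)$ consists of finite sets $U$ (offline vertices) and $V$ (online vertices), the edge set $E=U\times V$ (missing edges are edges of probability $0$), edge weights $w_e\in\mathbb{R}$, edge probabilities $p_e\in[0,1]$, and, for each $v\in V$, a nonempty set $\mathcal{C}_v$ of strings of pairwise distinct edges incident to $v$ that is downward-closed: every substring and every permutation of a string in $\mathcal{C}_v$ is in $\mathcal{C}_v$. Each edge $e$ is active independently with probability $p_e$. An offline probing algorithm knows $G$ but not which edges are active. It probes edges one at a time, in any order, adaptively and possibly with randomization; a probe of $e$ reveals whether $e$ is active, and if it is, the algorithm must irrevocably decide whether to include $e$ in its output before it probes another edge (the probe-commit model). For each $v\in V$ the string of probed edges incident to $v$ must belong to $\mathcal{C}_v$, and the output $\mathcal{M}$ must be a matching. Let $\mathrm{OPT}(G)$ be the maximum of $\mathbb{E}\bigl[\sum_{e\in\mathcal{M}}w_e\bigr]$ over all offline probing algorithms. For a string $\boldsymbol{e}$ of distinct edges put $q(\boldsymbol{e})=\prod_{f\in\boldsymbol{e}}(1-p_f)$ and $\mathrm{val}(\boldsymbol{e})=\sum_{f\in\boldsymbol{e}}w_f\,p_f\,q(\boldsymbol{e}_{<f})$,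 where $\boldsymbol{e}_{<f}$ is the part of $\boldsymbol{e}$ before $f$. Let $\mathrm{LPOPT}(G)$ be the optimum value of the configuration LP (LP-config) $$\begin{aligned} \text{maximize}\quad & \sum_{v\in V}\sum_{\boldsymbol{e}\in\mathcal{C}_v}\mathrm{val}(\boldsymbol{e})\,x_v(\boldsymbol{e})\\ \text{subject to}\quad & \sum_{v\in V}\ \sum_{\boldsymbol{e}\in\mathcal{C}_v:\,(u,v)\in\boldsymbol{e}}p_{u,v}\,q(\boldsymbol{e}_{<(u,v)})\,x_v(\boldsymbol{e})\le 1 && \forall u\in U,\\ & \sum_{\boldsymbol{e}\in\mathcal{C}_v}x_v(\boldsymbol{e})=1 && \forall v\in V,\\ & x_v(\boldsymbol{e})\ge 0 && \forall v\in V,\ \boldsymbol{e}\in\mathcal{C}_v. \end{aligned}$$ **Theorem.** For every stochastic graph $G$ both maxima are attained, and $\mathrm{OPT}(G)\le\mathrm{LPOPT}(G)$. -/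

import Mathlib

/-- A (bipartite) stochastic graph with offline vertices `U`, online vertices `V` and edge set
`U × V` (a missing edge is an edge of probability `0`), edge weights `w`, edge probabilities `p`,
and for each online vertex `v` a downward-closed probing constraint `C v`: a nonempty set of
strings of pairwise distinct edges incident to `v`, closed under substrings and permutations. -/
structure StochasticGraph (U V : Type*) where
  w : U × V → ℝ
  p : U × V → ℝ
  p_nonneg : ∀ e, 0 ≤ p e
  p_le_one : ∀ e, p e ≤ 1
  C : V → Finset (List (U × V))
  incident : ∀ v, ∀ s ∈ C v, ∀ e ∈ s, e.2 = v
  nodup : ∀ v, ∀ s ∈ C v, s.Nodup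
  C_nonempty : ∀ v, (C v).Nonempty
  substring_mem : ∀ v, ∀ s ∈ C v, ∀ s' : List (U × V), s' <:+: s → s' ∈ C v
  perm_mem : ∀ v, ∀ s ∈ C v, ∀ s' : List (U × V), s'.Perm s → s' ∈ C v

/-- A deterministic adaptive probing strategy in the probe-commit model, as a decision tree.
`halt` stops. `probe e take a i` probes the edge `e`; if `e` is active, it is irrevocably included
in the output (when `take = true`) or irrevocably rejected (when `take = false`), before the
strategy continues with `a`; if `e` is inactive, the strategy continues with `i`. -/
inductive ProbingTree (U V : Type*) where
  | halt : ProbingTree U V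
  | probe (e : U × V) (take : Bool) (a i : ProbingTree U V) : ProbingTree U V

namespace ProbingTree

variable {U V : Type*}

/-- The edges probed, in order, when the edge states are `st` (`st e = true` if `e` is active). -/
def probed : ProbingTree U V → (U × V → Bool) → List (U × V)
  | halt, _ => []
  | probe e _ a i, st => e :: (if st e = true then a.probed st else i.probed st)

/-- The set of edges returned when the edge states are `st`. -/
def output [DecidableEq U] [DecidableEq V] :
    ProbingTree U V → (U × V → Bool) → Finset (U × V)
  | halt, _ => ∅
  | probe e take a i, st =>
      if st e = true then
        (if take = true then insert e (a.output st) else a.output st)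
      else i.output st

end ProbingTree

namespace StochasticGraph

/-- A set of edges is a matching if distinct edges of it share no vertex. -/
def IsMatching {U V : Type*} (M : Finset (U × V)) : Prop :=
  ∀ e ∈ M, ∀ f ∈ M, (e.1 = f.1 ∨ e.2 = f.2) → e = f

/-- The decision tree `t` respects the probing constraints of `G` (for every online vertex `v`,
the string of probes to edges at `v` belongs to `C v`), and always returns a matching. -/
def Admissible {U V : Type*} [DecidableEq U] [DecidableEq V] (G : StochasticGraph U V)
    (t : ProbingTree U V) : Prop :=
  ∀ st : U × V → Bool,
    (∀ v : V, (t.probed st).filter (fun e => e.2 = v) ∈ G.C v) ∧ IsMatching (t.output st)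

/-- The probability of the edge states `st`: the edges are active independently, `e` with
probability `p e`. -/
noncomputable def stateProb {U V : Type*} [Fintype U] [Fintype V] (G : StochasticGraph U V)
    (st : U × V → Bool) : ℝ :=
  ∏ e : U × V, if st e = true then G.p e else 1 - G.p e

/-- The expected weight of the output of the decision tree `t`, over the edge states. -/
noncomputable def treeWeight {U V : Type*} [Fintype U] [Fintype V] [DecidableEq U] [DecidableEq V]
    (G : StochasticGraph U V) (t : ProbingTree U V) : ℝ :=
  ∑ st : U × V → Bool, G.stateProb st * ∑ e ∈ t.output st, G.w e

/-- A (randomized, adaptive) offline probing algorithm for `G`: a probability distribution,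
independent of the edge states, on admissible decision trees. As there are only countably many
decision trees, every random choice of one is described by a probability mass function. -/
structure OfflineAlgorithm {U V : Type*} [DecidableEq U] [DecidableEq V]
    (G : StochasticGraph U V) where
  law : PMF (ProbingTree U V)
  admissible : ∀ t ∈ law.support, G.Admissible t

/-- The expected weight of the matching returned by the algorithm `A`, over the edge states and
the random decisions of `A`. -/
noncomputable def expectedWeight {U V : Type*} [Fintype U] [Fintype V] [DecidableEq U]
    [DecidableEq V] (G : StochasticGraph U V) (A : G.OfflineAlgorithm) : ℝ :=
  ∑' t : ProbingTree U V, (A.law t).toReal * G.treeWeight t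

/-- The offline adaptive benchmark `OPT(G)`. -/
noncomputable def OPT {U V : Type*} [Fintype U] [Fintype V] [DecidableEq U] [DecidableEq V]
    (G : StochasticGraph U V) : ℝ :=
  sSup (Set.range G.expectedWeight)

/-- `q(s)`, the probability that all edges of the string `s` (of distinct edges) are inactive. -/
noncomputable def q {U V : Type*} (G : StochasticGraph U V) (s : List (U × V)) : ℝ :=
  (s.map fun f => 1 - G.p f).prod

/-- The part of the string `s` up to, but not including, the edge `f`. -/
def before {U V : Type*} [DecidableEq U] [DecidableEq V] (s : List (U × V)) (f : U × V) :
    List (U × V) :=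
  s.takeWhile (fun g => g ≠ f)

/-- `val(s)`, the expected weight of the first active edge if `s` is probed in order. -/
noncomputable def val {U V : Type*} [DecidableEq U] [DecidableEq V] (G : StochasticGraph U V)
    (s : List (U × V)) : ℝ :=
  (s.map fun f => G.w f * G.p f * G.q (before s f)).sum

/-- Feasibility for the configuration LP. Only the values `x v s` with `s ∈ C v` matter. -/
structure LPFeasible {U V : Type*} [Fintype V] [DecidableEq U] [DecidableEq V]
    (G : StochasticGraph U V) (x : V → List (U × V) → ℝ) : Prop where
  offline_le_one : ∀ u : U,
    ∑ v : V, ∑ s ∈ (G.C v).filter (fun s => (u, v) ∈ s),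
      G.p (u, v) * G.q (before s (u, v)) * x v s ≤ 1
  sum_eq_one : ∀ v : V, ∑ s ∈ G.C v, x v s = 1
  nonneg : ∀ v : V, ∀ s ∈ G.C v, 0 ≤ x v s

/-- The objective of the configuration LP. -/
noncomputable def lpObjective {U V : Type*} [Fintype V] [DecidableEq U] [DecidableEq V]
    (G : StochasticGraph U V) (x : V → List (U × V) → ℝ) : ℝ :=
  ∑ v : V, ∑ s ∈ G.C v, G.val s * x v s

/-- The set of objective values of feasible solutions of the configuration LP. -/
def lpValues {U V : Type*} [Fintype V] [DecidableEq U] [DecidableEq V]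
    (G : StochasticGraph U V) : Set ℝ :=
  {r | ∃ x, G.LPFeasible x ∧ G.lpObjective x = r}

/-- The optimum value `LPOPT(G)` of the configuration LP. -/
noncomputable def LPOPT {U V : Type*} [Fintype V] [DecidableEq U] [DecidableEq V]
    (G : StochasticGraph U V) : ℝ :=
  sSup G.lpValues

end StochasticGraph

/-! Fix an admissible tree `t`. For each `v`, run `t` while pretending that every edge at `v` it
would accept is inactive; all other edges get genuine random states. Record the edges at `v` that
would have been accepted, and let x_v be the law of this string. It is a sublist of a probe string
of `t` at `v`, so downward closure puts it in `G.C v`.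

Once an edge at `v` is accepted, the matching property forbids another. Hence `e` at `v` is output
exactly when the recorded edges before it are inactive and `e` is active: the probability that `e`
is output is the mean of `G.hitProb e` over the string (`stringMean_hitProb`). The constraint at `u`
thus bounds the expected number of output edges at `u`, and the LP objective equals `G.treeWeight t`
(`exists_lpFeasible_objective_eq`).

Randomization only averages trees, and tree weights take finitely many values, so a single tree
attains the first maximum; compactness gives the second. -/

set_option linter.unusedSectionVars false

/-! ### Runs of a tree under a change of one edge state -/

namespace ProbingTree

variable {U V : Type*} [DecidableEq U] [DecidableEq V]

/-- No edge is probed twice. -/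
def NoRepeat (t : ProbingTree U V) : Prop :=
  ∀ st : U × V → Bool, (t.probed st).Nodup

theorem output_subset_probed (t : ProbingTree U V) (st : U × V → Bool) :
    ∀ e ∈ t.output st, e ∈ t.probed st := by
  induction t with
  | halt => simp [output]
  | probe f take a i iha ihi =>
    intro e he
    simp only [output] at he
    simp only [probed, List.mem_cons]
    by_cases hf : st f = true
    · simp only [hf, if_true] at he ⊢
      cases take
      · exact Or.inr (iha e (by simpa using he))
      · simp only [if_true, Finset.mem_insert] at he
        exact he.imp_right (iha e)
    · simp only [hf] at he ⊢
      exact Or.inr (ihi e he)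

theorem update_of_notMem_probed (t : ProbingTree U V) {st : U × V → Bool} {e : U × V}
    (he : e ∉ t.probed st) (b : Bool) :
    t.probed (Function.update st e b) = t.probed st ∧
      t.output (Function.update st e b) = t.output st := by
  induction t with
  | halt => simp [output, probed]
  | probe f take a i iha ihi =>
    simp only [probed, List.mem_cons, not_or] at he
    have hf : Function.update st e b f = st f := Function.update_of_ne (Ne.symm he.1) _ _
    simp only [probed, output, hf]
    by_cases h : st f = true
    · simp only [h, if_true] at he ⊢
      rw [(iha he.2).1, (iha he.2).2]
      exact ⟨rfl, rfl⟩
    · simp only [h] at he ⊢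
      rw [(ihi he.2).1, (ihi he.2).2]
      exact ⟨rfl, rfl⟩

section probe

variable {f : U × V} {take : Bool} {a i : ProbingTree U V}

/-- Forcing `f` active sends the run into `a`, which then cannot probe `f`; a run that does not
probe `f` is unaffected by resetting its state. -/
theorem NoRepeat.notMem_active (h : (probe f take a i).NoRepeat) (st : U × V → Bool) :
    f ∉ a.probed st := by
  have h1 := h (Function.update st f true)
  simp only [probed, Function.update_self, if_true, List.nodup_cons] at h1
  have h2 := (a.update_of_notMem_probed h1.1 (st f)).1
  rw [Function.update_idem, Function.update_eq_self] at h2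
  rw [h2]
  exact h1.1

theorem NoRepeat.notMem_inactive (h : (probe f take a i).NoRepeat) (st : U × V → Bool) :
    f ∉ i.probed st := by
  have h1 := h (Function.update st f false)
  simp only [probed, Function.update_self, Bool.false_eq_true, if_false, List.nodup_cons] at h1
  have h2 := (i.update_of_notMem_probed h1.1 (st f)).1
  rw [Function.update_idem, Function.update_eq_self] at h2
  rw [h2]
  exact h1.1

theorem NoRepeat.probed_update_true (h : (probe f take a i).NoRepeat) (st : U × V → Bool) :
    (probe f take a i).probed (Function.update st f true) = f :: a.probed st := by
  simp [probed, (a.update_of_notMem_probed (h.notMem_active st) true).1]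

theorem NoRepeat.probed_update_false (h : (probe f take a i).NoRepeat) (st : U × V → Bool) :
    (probe f take a i).probed (Function.update st f false) = f :: i.probed st := by
  simp [probed, (i.update_of_notMem_probed (h.notMem_inactive st) false).1]

theorem NoRepeat.output_update_true (h : (probe f take a i).NoRepeat) (st : U × V → Bool) :
    (probe f take a i).output (Function.update st f true) =
      if take = true then insert f (a.output st) else a.output st := by
  simp [output, (a.update_of_notMem_probed (h.notMem_active st) true).2]

theorem NoRepeat.output_update_false (h : (probe f take a i).NoRepeat) (st : U × V → Bool) :
    (probe f take a i).output (Function.update st f false) = i.output st := by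
  simp [output, (i.update_of_notMem_probed (h.notMem_inactive st) false).2]

theorem NoRepeat.active (h : (probe f take a i).NoRepeat) : a.NoRepeat := fun st => by
  have h1 := h (Function.update st f true)
  rw [h.probed_update_true] at h1
  exact (List.nodup_cons.1 h1).2

theorem NoRepeat.inactive (h : (probe f take a i).NoRepeat) : i.NoRepeat := fun st => by
  have h1 := h (Function.update st f false)
  rw [h.probed_update_false] at h1
  exact (List.nodup_cons.1 h1).2

end probe

end ProbingTree

namespace StochasticGraph

open ProbingTree

variable {U V : Type*} [DecidableEq U] [DecidableEq V]

theorem IsMatching.mono {M N : Finset (U × V)} (hN : IsMatching N) (h : M ⊆ N) : IsMatching M :=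
  fun e he f hf => hN e (h he) f (h hf)

/-! ### The random string recorded at an online vertex -/

/-- The expectation of `g` over the following random string of edges at `v`: follow the tree `t`,
pretending that the edges at `v` which `t` would accept are all inactive, and record these edges. -/
noncomputable def stringMean (G : StochasticGraph U V) (v : V) :
    ProbingTree U V → (List (U × V) → ℝ) → ℝ
  | .halt, g => g []
  | .probe f take a i, g =>
      if f.2 = v ∧ take = true then stringMean G v i (fun s => g (f :: s))
      else G.p f * stringMean G v a g + (1 - G.p f) * stringMean G v i g

variable (G : StochasticGraph U V)

theorem stringMean_const (v : V) (t : ProbingTree U V) (c : ℝ) :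
    G.stringMean v t (fun _ => c) = c := by
  induction t with
  | halt => rfl
  | probe f take a i iha ihi =>
    simp only [stringMean, iha, ihi]
    split_ifs
    · rfl
    · ring

theorem stringMean_nonneg (v : V) (t : ProbingTree U V) {g : List (U × V) → ℝ}
    (hg : ∀ s, 0 ≤ g s) : 0 ≤ G.stringMean v t g := by
  induction t generalizing g with
  | halt => exact hg []
  | probe f take a i iha ihi =>
    simp only [stringMean]
    split_ifs
    · exact ihi fun s => hg _
    · exact add_nonneg (mul_nonneg (G.p_nonneg f) (iha hg))
        (mul_nonneg (sub_nonneg.2 (G.p_le_one f)) (ihi hg))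

theorem stringMean_sum {ι : Type*} (v : V) (t : ProbingTree U V) (F : Finset ι) (c : ι → ℝ)
    (g : ι → List (U × V) → ℝ) :
    G.stringMean v t (fun s => ∑ k ∈ F, c k * g k s) = ∑ k ∈ F, c k * G.stringMean v t (g k) := by
  induction t generalizing g with
  | halt => rfl
  | probe f take a i iha ihi =>
    simp only [stringMean]
    split_ifs
    · exact ihi fun k s => g k (f :: s)
    · rw [iha, ihi, Finset.mul_sum, Finset.mul_sum, ← Finset.sum_add_distrib]
      exact Finset.sum_congr rfl fun k _ => by ring

theorem stringMean_const_mul (v : V) (t : ProbingTree U V) (c : ℝ) (g : List (U × V) → ℝ) :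
    G.stringMean v t (fun s => c * g s) = c * G.stringMean v t g := by
  simpa using G.stringMean_sum v t {()} (fun _ => c) (fun _ => g)

theorem stringMean_congr (v : V) {t : ProbingTree U V} (ht : t.NoRepeat)
    {g g' : List (U × V) → ℝ}
    (h : ∀ st s, s.Sublist ((t.probed st).filter fun e => e.2 = v) → g s = g' s) :
    G.stringMean v t g = G.stringMean v t g' := by
  induction t generalizing g g' with
  | halt => exact h (fun _ => true) [] (List.nil_sublist _)
  | probe f take a i iha ihi =>
    simp only [stringMean]
    split_ifs with hf
    -- The pretence is realized by an actual state, the one in which `f` is inactive.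
    · refine ihi ht.inactive fun st s hs => h (Function.update st f false) _ ?_
      rw [ht.probed_update_false, List.filter_cons_of_pos (by simpa using hf.1)]
      exact hs.cons_cons f
    · rw [iha ht.active (g' := g'), ihi ht.inactive (g' := g')]
      · intro st s hs
        refine h (Function.update st f false) _ (hs.trans ?_)
        rw [ht.probed_update_false]
        exact (List.sublist_cons_self _ _).filter _
      · intro st s hs
        refine h (Function.update st f true) _ (hs.trans ?_)
        rw [ht.probed_update_true]
        exact (List.sublist_cons_self _ _).filter _

/-- The probability that `e` is probed and active if `s` is probed in order until the first active
edge. -/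
noncomputable def hitProb (e : U × V) (s : List (U × V)) : ℝ :=
  if e ∈ s then G.p e * G.q (before s e) else 0

theorem hitProb_cons_self (e : U × V) (s : List (U × V)) : G.hitProb e (e :: s) = G.p e := by
  simp [hitProb, before, q]

theorem hitProb_cons_of_ne {e f : U × V} (h : e ≠ f) (s : List (U × V)) :
    G.hitProb e (f :: s) = (1 - G.p f) * G.hitProb e s := by
  simp only [hitProb, List.mem_cons, h, false_or]
  split_ifs
  · simp [before, q, h.symm]
    ring
  · simp

/-! ### Downward closure and the support of the recorded string -/

section constraints

variable {G} {t : ProbingTree U V}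

/-- A sublist need not be contiguous, but some permutation of `s` has it as a prefix. -/
theorem sublist_mem {v : V} {s s' : List (U × V)} (hs : s ∈ G.C v) (h : s'.Sublist s) :
    s' ∈ G.C v := by
  obtain ⟨l, hl⟩ := h.exists_perm_append
  exact G.substring_mem v _ (G.perm_mem v s hs _ hl.symm) s' (List.prefix_append _ _).isInfix

theorem nil_mem (v : V) : [] ∈ G.C v := by
  obtain ⟨s, hs⟩ := G.C_nonempty v
  exact sublist_mem hs (List.nil_sublist s)

theorem Admissible.noRepeat (ht : G.Admissible t) : t.NoRepeat := by
  intro st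
  rw [List.nodup_iff_count_le_one]
  intro e
  have h := List.nodup_iff_count_le_one.1 (G.nodup e.2 _ ((ht st).1 e.2)) e
  rwa [List.count_filter (by simp)] at h

theorem admissible_halt : G.Admissible .halt := fun st =>
  ⟨fun v => by simpa [probed] using nil_mem v, by simp [output, IsMatching]⟩

theorem stringMean_eq_sum (ht : G.Admissible t) (v : V) (g : List (U × V) → ℝ) :
    G.stringMean v t g =
      ∑ s ∈ G.C v, g s * G.stringMean v t (fun s' => if s' = s then 1 else 0) := by
  rw [← stringMean_sum]
  refine G.stringMean_congr v ht.noRepeat fun st s hs => ?_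
  simp [sublist_mem ((ht st).1 v) hs]

end constraints

variable [Fintype U] [Fintype V]

theorem val_eq_sum {v : V} {s : List (U × V)} (hs : s ∈ G.C v) :
    G.val s = ∑ u : U, G.w (u, v) * G.hitProb (u, v) s := by
  have h1 : G.val s = ∑ e ∈ s.toFinset, G.w e * G.hitProb e s := by
    rw [val, ← List.sum_toFinset _ (G.nodup v s hs)]
    refine Finset.sum_congr rfl fun e he => ?_
    rw [hitProb, if_pos (List.mem_toFinset.1 he), mul_assoc]
  let emb : U ↪ U × V := ⟨fun u => (u, v), fun _ _ h => (Prod.ext_iff.1 h).1⟩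
  refine h1.trans (Eq.trans ?_
    (Finset.sum_map Finset.univ emb fun e => G.w e * G.hitProb e s))
  refine Finset.sum_subset (fun e he => ?_) (fun e _ he => ?_)
  · have := G.incident v s hs e (List.mem_toFinset.1 he)
    exact Finset.mem_map.2 ⟨e.1, Finset.mem_univ _, Prod.ext rfl this.symm⟩
  · rw [hitProb, if_neg (fun h => he (List.mem_toFinset.2 h)), mul_zero]

/-! ### Expectation over edge states -/

/-- The expectation of `h` over the edge states. -/
noncomputable def stateMean (h : (U × V → Bool) → ℝ) : ℝ :=
  ∑ st : U × V → Bool, G.stateProb st * h st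

theorem stateProb_nonneg (st : U × V → Bool) : 0 ≤ G.stateProb st :=
  Finset.prod_nonneg fun e _ => by
    split_ifs
    · exact G.p_nonneg e
    · exact sub_nonneg.2 (G.p_le_one e)

theorem stateMean_const (c : ℝ) : G.stateMean (fun _ => c) = c := by
  have h : ∑ st : U × V → Bool, G.stateProb st = 1 := by
    have := (Finset.prod_univ_sum (fun _ : U × V => (Finset.univ : Finset Bool))
      (fun e b => if b = true then G.p e else 1 - G.p e))
    rw [Fintype.piFinset_univ] at this
    simp only [stateProb]
    rw [← this]
    simp
  rw [stateMean, ← Finset.sum_mul, h, one_mul]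

theorem stateMean_mono {h h' : (U × V → Bool) → ℝ} (hh : ∀ st, h st ≤ h' st) :
    G.stateMean h ≤ G.stateMean h' :=
  Finset.sum_le_sum fun st _ => mul_le_mul_of_nonneg_left (hh st) (G.stateProb_nonneg st)

theorem stateMean_sum {ι : Type*} (F : Finset ι) (c : ι → ℝ) (h : ι → (U × V → Bool) → ℝ) :
    G.stateMean (fun st => ∑ k ∈ F, c k * h k st) = ∑ k ∈ F, c k * G.stateMean (h k) := by
  simp only [stateMean, Finset.mul_sum]
  rw [Finset.sum_comm]
  exact Finset.sum_congr rfl fun k _ => Finset.sum_congr rfl fun st _ => by ring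

/-- Pairs the states that differ only at `e`; the one with `e` active represents the pair. -/
theorem sum_update (e : U × V) (F : (U × V → Bool) → ℝ) :
    ∑ st, F st = ∑ st : U × V → Bool, if st e = true then
      F (Function.update st e true) + F (Function.update st e false) else 0 := by
  have hflip : ∑ st : U × V → Bool, (if st e = true then 0 else F st) =
      ∑ st : U × V → Bool, if st e = true then F (Function.update st e false) else 0 := by
    let σ : (U × V → Bool) → (U × V → Bool) := fun st => Function.update st e (!st e)
    have hσ : Function.Involutive σ := fun st => by simp [σ]
    rw [← Equiv.sum_comp hσ.toPerm]
    refine Finset.sum_congr rfl fun st _ => ?_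
    by_cases h : st e = true <;> simp [σ, h]
  have hsplit : ∑ st, F st = (∑ st : U × V → Bool, if st e = true then F st else 0) +
      ∑ st : U × V → Bool, if st e = true then 0 else F st := by
    rw [← Finset.sum_add_distrib]
    exact Finset.sum_congr rfl fun st _ => by split_ifs <;> simp
  rw [hsplit, hflip, ← Finset.sum_add_distrib]
  refine Finset.sum_congr rfl fun st _ => ?_
  split_ifs with h
  · rw [← h, Function.update_eq_self]
  · simp

theorem stateProb_update (e : U × V) (st : U × V → Bool) (b : Bool) :
    G.stateProb (Function.update st e b) = (if b = true then G.p e else 1 - G.p e) *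
      ∏ f ∈ Finset.univ.erase e, if st f = true then G.p f else 1 - G.p f := by
  rw [stateProb, ← Finset.mul_prod_erase _ _ (Finset.mem_univ e), Function.update_self]
  congr 1
  refine Finset.prod_congr rfl fun f hf => ?_
  rw [Function.update_of_ne (Finset.ne_of_mem_erase hf)]

/-- Conditioning on the state of `e`: the hypotheses force `h₁` and `h₀` to be independent of that
state. -/
theorem stateMean_eq_of_update (e : U × V) {h h₁ h₀ : (U × V → Bool) → ℝ}
    (ht : ∀ st, h (Function.update st e true) = h₁ st)
    (hf : ∀ st, h (Function.update st e false) = h₀ st) :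
    G.stateMean h = G.p e * G.stateMean h₁ + (1 - G.p e) * G.stateMean h₀ := by
  have k₁ : ∀ st b, h₁ (Function.update st e b) = h₁ st := fun st b => by
    rw [← ht, ← ht, Function.update_idem]
  have k₀ : ∀ st b, h₀ (Function.update st e b) = h₀ st := fun st b => by
    rw [← hf, ← hf, Function.update_idem]
  simp only [stateMean]
  rw [sum_update e, sum_update e (fun st => _ * h₁ st), sum_update e (fun st => _ * h₀ st),
    Finset.mul_sum, Finset.mul_sum, ← Finset.sum_add_distrib]
  refine Finset.sum_congr rfl fun st _ => ?_
  split_ifs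
  · simp only [ht, hf, k₁, k₀, stateProb_update, if_true, Bool.false_eq_true, if_false]
    ring
  · simp

/-! ### From output probabilities to a feasible LP solution -/

theorem stringMean_hitProb {v : V} {e : U × V} (he : e.2 = v) {t : ProbingTree U V}
    (ht : t.NoRepeat) (hm : ∀ st, IsMatching (t.output st)) :
    G.stringMean v t (G.hitProb e) =
      G.stateMean (fun st => if e ∈ t.output st then 1 else 0) := by
  induction t with
  | halt => simp [stringMean, hitProb, output, stateMean_const]
  | probe f take a i iha ihi =>
    have ht1 := ht.output_update_true
    have ht0 := ht.output_update_false
    have hma : ∀ st, IsMatching (a.output st) := fun st => by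
      refine (hm (Function.update st f true)).mono ?_
      rw [ht1]
      split_ifs
      · exact Finset.subset_insert _ _
      · exact subset_rfl
    have hmi : ∀ st, IsMatching (i.output st) := fun st => by
      have := hm (Function.update st f false)
      rwa [ht0] at this
    rw [stringMean, G.stateMean_eq_of_update f (fun st => by rw [ht1]) (fun st => by rw [ht0])]
    by_cases hf : f.2 = v ∧ take = true
    · rw [if_pos hf]
      simp only [hf.2, if_true]
      by_cases hef : e = f
      · subst hef
        have hi : ∀ st, e ∉ i.output st := fun st h =>
          ht.notMem_inactive st (i.output_subset_probed st e h)
        simp [hitProb_cons_self, stringMean_const, hi, stateMean_const]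
      -- Accepting `f` blocks `v`, so only the inactive branch contributes, with the factor `1 - G.p
      -- f` that `hitProb` also picks up.
      · have hins : ∀ st, e ∉ insert f (a.output st) := fun st h => by
          have h1 := hm (Function.update st f true)
          rw [ht1, if_pos hf.2] at h1
          exact hef (h1 e h f (Finset.mem_insert_self _ _) (Or.inr (he.trans hf.1.symm)))
        simp only [G.hitProb_cons_of_ne hef, stringMean_const_mul, ihi ht.inactive hmi, hins,
          if_false, stateMean_const]
        ring
    · rw [if_neg hf, iha ht.active hma, ihi ht.inactive hmi]
      congr 3
      funext st
      by_cases htake : take = true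
      · have hef : e ≠ f := fun h => hf ⟨h ▸ he, htake⟩
        simp [htake, hef]
      · simp [htake]

theorem treeWeight_eq_sum (t : ProbingTree U V) :
    G.treeWeight t =
      ∑ e : U × V, G.w e * G.stateMean (fun st => if e ∈ t.output st then 1 else 0) := by
  rw [← stateMean_sum]
  simp [treeWeight, stateMean]

theorem exists_lpFeasible_objective_eq {t : ProbingTree U V} (ht : G.Admissible t) :
    ∃ x, G.LPFeasible x ∧ G.lpObjective x = G.treeWeight t := by
  have hit : ∀ u v, G.stringMean v t (G.hitProb (u, v)) =
      G.stateMean (fun st => if (u, v) ∈ t.output st then 1 else 0) := fun u v =>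
    G.stringMean_hitProb (v := v) (e := (u, v)) rfl ht.noRepeat fun st => (ht st).2
  refine ⟨fun v s => G.stringMean v t (fun s' => if s' = s then 1 else 0), ⟨fun u => ?_,
    fun v => ?_, fun v s _ => G.stringMean_nonneg v t fun s' => by split_ifs <;> norm_num⟩, ?_⟩
  · have h : ∀ v, ∑ s ∈ (G.C v).filter (fun s => (u, v) ∈ s), G.p (u, v) *
        G.q (before s (u, v)) * G.stringMean v t (fun s' => if s' = s then 1 else 0) =
        1 * G.stateMean (fun st => if (u, v) ∈ t.output st then 1 else 0) := fun v => by
      rw [one_mul, ← hit, stringMean_eq_sum ht, Finset.sum_filter]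
      refine Finset.sum_congr rfl fun s _ => ?_
      rw [hitProb]
      split_ifs <;> simp
    simp only [h]
    rw [← stateMean_sum]
    refine (G.stateMean_mono fun st => ?_).trans (G.stateMean_const 1).le
    simp only [one_mul, Finset.sum_boole]
    norm_cast
    -- In every state, the output has at most one edge at `u`.
    refine Finset.card_le_one.2 fun v hv v' hv' => ?_
    simp only [Finset.mem_filter, Finset.mem_univ, true_and] at hv hv'
    exact (Prod.ext_iff.1 ((ht st).2 _ hv _ hv' (Or.inl rfl))).2
  · simpa [stringMean_const] using (stringMean_eq_sum ht v (fun _ => 1)).symm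
  · rw [treeWeight_eq_sum, Fintype.sum_prod_type_right, lpObjective]
    refine Finset.sum_congr rfl fun v _ => ?_
    simp only [← hit]
    refine Eq.trans ?_ ((stringMean_eq_sum ht v _).symm.trans (G.stringMean_sum v t Finset.univ
      (fun u => G.w (u, v)) (fun u => G.hitProb (u, v))))
    exact Finset.sum_congr rfl fun s hs => by rw [G.val_eq_sum hs]

/-! ### Attainment of both maxima -/

theorem LPFeasible.le_one {G : StochasticGraph U V} {x : V → List (U × V) → ℝ}
    (hx : G.LPFeasible x) (v : V) {s : List (U × V)} (hs : s ∈ G.C v) : x v s ≤ 1 :=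
  (Finset.single_le_sum (f := x v) (hx.nonneg v) hs).trans_eq (hx.sum_eq_one v)

theorem isCompact_lpValues : IsCompact G.lpValues := by
  let K : Set (V → List (U × V) → ℝ) :=
    Set.pi Set.univ (fun _ => Set.pi Set.univ fun _ => Set.Icc 0 1) ∩ {x | G.LPFeasible x}
  have hev : ∀ v s, Continuous fun x : V → List (U × V) → ℝ => x v s := fun v s => by fun_prop
  have hclosed : IsClosed {x | G.LPFeasible x} := by
    have : {x | G.LPFeasible x} =
        (⋂ u : U, {x | ∑ v : V, ∑ s ∈ (G.C v).filter (fun s => (u, v) ∈ s),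
          G.p (u, v) * G.q (before s (u, v)) * x v s ≤ 1}) ∩
        ((⋂ v : V, {x | ∑ s ∈ G.C v, x v s = 1}) ∩ ⋂ v : V, ⋂ s ∈ G.C v, {x | 0 ≤ x v s}) := by
      ext x
      simp only [Set.mem_inter_iff, Set.mem_iInter, Set.mem_ofPred_eq]
      exact ⟨fun h => ⟨h.1, h.2, h.3⟩, fun h => ⟨h.1, h.2.1, h.2.2⟩⟩
    rw [this]
    refine (isClosed_iInter fun u => isClosed_le ?_ continuous_const).inter
      ((isClosed_iInter fun v => isClosed_eq ?_ continuous_const).inter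
        (isClosed_iInter fun v => isClosed_iInter fun s => isClosed_iInter fun _ =>
          isClosed_le continuous_const (hev v s)))
    · exact continuous_finsetSum _ fun v _ => continuous_finsetSum _ fun s _ =>
        continuous_const.mul (hev v s)
    · exact continuous_finsetSum _ fun s _ => hev v s
  have hK : IsCompact K :=
    (isCompact_univ_pi fun _ => isCompact_univ_pi fun _ => isCompact_Icc).inter_right hclosed
  have hcont : Continuous G.lpObjective :=
    continuous_finsetSum _ fun v _ => continuous_finsetSum _ fun s _ =>
      continuous_const.mul (hev v s)
  convert hK.image hcont using 1
  ext r
  constructor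
  · rintro ⟨x, hx, rfl⟩
    -- Values off `G.C v` are unconstrained; setting them to `0` moves the solution into the compact
    -- box.
    let y : V → List (U × V) → ℝ := fun v s => if s ∈ G.C v then x v s else 0
    have hy : ∀ v, ∀ s ∈ G.C v, y v s = x v s := fun v s hs => if_pos hs
    refine ⟨y, ⟨fun v _ s _ => ?_, ⟨fun u => ?_, fun v => ?_, fun v s hs => ?_⟩⟩, ?_⟩
    · by_cases hs : s ∈ G.C v
      · rw [hy v s hs]
        exact ⟨hx.nonneg v s hs, hx.le_one v hs⟩
      · simp [y, hs]
    · refine le_of_eq_of_le (Finset.sum_congr rfl fun v _ => Finset.sum_congr rfl fun s hs => ?_)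
        (hx.offline_le_one u)
      rw [hy v s (Finset.mem_filter.1 hs).1]
    · rw [← hx.sum_eq_one v]
      exact Finset.sum_congr rfl (hy v)
    · rw [hy v s hs]
      exact hx.nonneg v s hs
    · exact Finset.sum_congr rfl fun v _ => Finset.sum_congr rfl fun s hs => by rw [hy v s hs]
  · rintro ⟨x, hx, rfl⟩
    exact ⟨x, hx.2, rfl⟩

/-- There are infinitely many trees, but the weight depends only on the output map, one of finitely
many functions. -/
theorem finite_range_treeWeight : (Set.range G.treeWeight).Finite := by
  refine (Set.finite_range fun M : (U × V → Bool) → Finset (U × V) =>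
    ∑ st, G.stateProb st * ∑ e ∈ M st, G.w e).subset ?_
  rintro _ ⟨t, rfl⟩
  exact ⟨t.output, rfl⟩

theorem exists_isGreatest_expectedWeight :
    ∃ t, G.Admissible t ∧ IsGreatest (Set.range G.expectedWeight) (G.treeWeight t) := by
  obtain ⟨_, ⟨t, ht, rfl⟩, hmax⟩ := Set.exists_max_image (G.treeWeight '' {t | G.Admissible t}) id
    (G.finite_range_treeWeight.subset (Set.image_subset_range _ _))
    ⟨_, _, admissible_halt, rfl⟩
  refine ⟨t, ht, ⟨⟨PMF.pure t, fun t' h => ?_⟩, ?_⟩, ?_⟩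
  · rw [PMF.support_pure, Set.mem_singleton_iff] at h
    exact h ▸ ht
  · rw [expectedWeight, tsum_eq_single t fun t' h => by simp [PMF.pure_apply, h]]
    simp
  · rintro _ ⟨A, rfl⟩
    have hlaw : HasSum (fun t' => (A.law t').toReal) 1 := by
      have := ENNReal.hasSum_toReal A.law.tsum_coe_ne_top
      rwa [← ENNReal.tsum_toReal_eq A.law.apply_ne_top, A.law.tsum_coe, ENNReal.toReal_one] at this
    obtain ⟨B, hB⟩ := (G.finite_range_treeWeight.image fun r => |r|).bddAbove
    have hsum : Summable fun t' => (A.law t').toReal * G.treeWeight t' := by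
      refine Summable.of_norm_bounded (hlaw.summable.mul_right B) fun t' => ?_
      rw [norm_mul, Real.norm_of_nonneg ENNReal.toReal_nonneg]
      exact mul_le_mul_of_nonneg_left (hB ⟨_, ⟨t', rfl⟩, rfl⟩) ENNReal.toReal_nonneg
    have hbound := hlaw.mul_right (G.treeWeight t)
    rw [one_mul] at hbound
    refine hasSum_le (fun t' => ?_) hsum.hasSum hbound
    by_cases h : t' ∈ A.law.support
    · exact mul_le_mul_of_nonneg_left (hmax _ ⟨t', A.admissible t' h, rfl⟩) ENNReal.toReal_nonneg
    · simp [(A.law.apply_eq_zero_iff t').2 h]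

end StochasticGraph

theorem theorem1 {U V : Type*} [Fintype U] [Fintype V] [DecidableEq U] [DecidableEq V]
    (G : StochasticGraph U V) :
    IsGreatest (Set.range G.expectedWeight) G.OPT ∧
    IsGreatest G.lpValues G.LPOPT ∧
    G.OPT ≤ G.LPOPT := by
  obtain ⟨t, ht, hgreatest⟩ := G.exists_isGreatest_expectedWeight
  have hOPT : G.OPT = G.treeWeight t := hgreatest.csSup_eq
  have hmem : G.treeWeight t ∈ G.lpValues := G.exists_lpFeasible_objective_eq ht
  have hLP : IsGreatest G.lpValues G.LPOPT := G.isCompact_lpValues.isGreatest_sSup ⟨_, hmem⟩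
  rw [hOPT]
  exact ⟨hgreatest, hLP, hLP.2 hmem⟩
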